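/- \textbf{Theorem (Abhyankar--Gurjar inversion formula).} Let $K$ be a field of characteristic zero, $n\ge 0$ an integer, $z=(z_1,\dots,z_n)$ commuting variables and $\partial_i=\partial/\partial z_i$. For a tuple $h$ of elements of $K[[z]]$ let $o(h)$ be the minimum of the orders of its components. Let $F=z-H$ with $H=(H_1,\dots,H_n)\in K[[z]]^{n}$ and $o(H)\ge 2$, and let $\mathcal JF=\det(\partial_jF_i)$. For $\alpha\in\mathbb N^n$ write $|\alpha|=\sum_i\alpha_i$, $\alpha!=\prod_i\alpha_i!$, $H^\alpha=\prod_iH_i^{\alpha_i}$ and $\partial^\alpha=\prod_i\partial_i^{\alpha_i}$. Then $F$ has a unique formal inverse map, i.e. there is exactly one $G\in K[[z]]^n$ with $G(0)=0$, $F(G(z))=z$ and $G(F(z))=z$; it has the form $G=z+N$ with $o(N)\ge 2$. For every $u\in K[[z]]$, $$u(G)=\sum_{\alpha\in\mathbb N^n}\frac1{\alpha!}\,\partial^\alpha\bigl(u\,H^\alpha\,\mathcal JF\bigr)=\Bigl(\sum_{\alpha\in\mathbb N^n}\frac1{\alpha!}\,\partial^\alpha H^\alpha\,\mathcal JF\Bigr)\cdot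 u .$$ Here the first sum converges formally in $K[[z]]$ (each monomial occurs in only finitely many terms). In the second expression $\partial^\alpha H^\alpha\mathcal JF$ denotes the composition of $\partial^\alpha$ with the multiplication operators by $H^\alpha$ and $\mathcal JF$, and the sum converges in the completed Weyl algebra, acting on $K[[z]]$: the algebra of sums $\sum_{m\in\mathbb Z}u_m$ with $u_m$ in the span of the $z^\beta\partial^\alpha$ with $|\beta|-|\alpha|=m$ and $u_m=0$ for all sufficiently negative $m$; convergence means that for each $M\in\mathbb Z$ the finite partial sums over all sufficiently large finite sets of $\alpha$ agree with the sum up to an element with $u_m=0$ for all $m<M$. In particular, $G$ is given componentwise by $$G=\sum_{\alpha\in\mathbb N^n}\frac1{\alpha!}\,\partial^\alpha\bigl(z\,H^\alpha\,\mathcal JF\bigr).$$ -/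

import Mathlib

noncomputable section

namespace AbhyankarGurjar

open MvPowerSeries

variable {K : Type*} [Field K] {n : ℕ}

/-- The order `o(h) = min_i o(h_i)` of a tuple of formal power series
(the order of the zero series, and of the empty tuple, is `⊤`). -/
def tupleOrder (h : Fin n → MvPowerSeries (Fin n) K) : ℕ∞ :=
  ⨅ i, (h i).order

/-- The sum of the (possibly infinite) family `f` of formal power series exists and equals `s`:
convergence for the product topology on the coefficients, the field `K` being discrete.
Equivalently, every monomial occurs in only finitely many `f i`, and the coefficients add up
to those of `s`. -/
def FormalHasSum {ι : Type*} (f : ι → MvPowerSeries (Fin n) K)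
    (s : MvPowerSeries (Fin n) K) : Prop :=
  letI : TopologicalSpace K := ⊥
  letI : TopologicalSpace (MvPowerSeries (Fin n) K) :=
    MvPowerSeries.WithPiTopology.instTopologicalSpace K
  HasSum f s

/-- `G` is the formal inverse map of the formal map `F`: `G(0) = 0`, `F(G(z)) = z` and
`G(F(z)) = z`. -/
structure IsFormalInverse (F G : Fin n → MvPowerSeries (Fin n) K) : Prop where
  constantCoeff_eq_zero : ∀ i, constantCoeff (G i) = 0
  comp_right : ∀ i, subst G (F i) = (X i : MvPowerSeries (Fin n) K)
  comp_left : ∀ i, subst F (G i) = (X i : MvPowerSeries (Fin n) K)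

/-- The Jacobian determinant `det (∂_j F_i)`. -/
def jacobian (F : Fin n → MvPowerSeries (Fin n) K) : MvPowerSeries (Fin n) K :=
  (Matrix.of fun i j => pderiv K j (F i)).det

/-- `α! = α_1! ⋯ α_n!`. -/
def multiFactorial (α : Fin n →₀ ℕ) : ℕ :=
  ∏ i, (α i).factorial

/-- `H^α = H_1^{α_1} ⋯ H_n^{α_n}`. -/
def multiPow (H : Fin n → MvPowerSeries (Fin n) K) (α : Fin n →₀ ℕ) :
    MvPowerSeries (Fin n) K :=
  ∏ i, H i ^ α i

/-- The operator `∂^α = ∂_1^{α_1} ∘ ⋯ ∘ ∂_n^{α_n}` on formal power series. -/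
def partialPow (α : Fin n →₀ ℕ) : Module.End K (MvPowerSeries (Fin n) K) :=
  ((List.finRange n).map fun i =>
    ((pderiv K i : Derivation K (MvPowerSeries (Fin n) K) (MvPowerSeries (Fin n) K)) :
      Module.End K (MvPowerSeries (Fin n) K)) ^ α i).prod

/-- The operator of multiplication by the formal power series `h`. -/
def mulOp (h : MvPowerSeries (Fin n) K) : Module.End K (MvPowerSeries (Fin n) K) :=
  LinearMap.mulLeft K h

/-- The homogeneous component `D_m` of the Weyl algebra in degree `m : ℤ`, spanned by the
operators `z^β ∂^α` with `|β| - |α| = m`. Over a field of characteristic zero the Weyl algebra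
acts faithfully on formal power series, and it is identified with its image. -/
def weylHomogeneous (K : Type*) [Field K] (n : ℕ) (m : ℤ) :
    Submodule K (Module.End K (MvPowerSeries (Fin n) K)) :=
  Submodule.span K
    {P | ∃ α β : Fin n →₀ ℕ, (β.degree : ℤ) - (α.degree : ℤ) = m ∧
      P = mulOp (monomial β 1) * partialPow α}

/-- The elements `∑_m u_m` with `u_m ∈ D_m`, and `u_m = 0` for `m < M`, of the completion of the
`ℤ`-graded Weyl algebra (that is, those of grading at least `M`), as operators on formal power
series: the operator attached to `∑_m u_m` maps `f` to the formal sum of the `u_m f`. -/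
def completedWeylGE (K : Type*) [Field K] (n : ℕ) (M : ℤ) :
    Set (Module.End K (MvPowerSeries (Fin n) K)) :=
  {T | ∃ u : ℤ → Module.End K (MvPowerSeries (Fin n) K),
    (∀ m, u m ∈ weylHomogeneous K n m) ∧ (∀ m, m < M → u m = 0) ∧
      ∀ f, FormalHasSum (fun m => u m f) (T f)}

/-- The completion of the Weyl algebra with respect to its `ℤ`-grading, acting on formal power
series: all sums `∑_m u_m` with `u_m ∈ D_m`, and `u_m = 0` for `m` negative enough. -/
def completedWeyl (K : Type*) [Field K] (n : ℕ) :
    Set (Module.End K (MvPowerSeries (Fin n) K)) :=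
  ⋃ M : ℤ, completedWeylGE K n M

/-- The family `P` of elements of the completed Weyl algebra has the sum `T` in the completed Weyl
algebra: for every `M`, the finite partial sums eventually agree with `T` up to an element of
grading at least `M`. -/
def WeylHasSum {ι : Type*} (P : ι → Module.End K (MvPowerSeries (Fin n) K))
    (T : Module.End K (MvPowerSeries (Fin n) K)) : Prop :=
  (∀ i, P i ∈ completedWeyl K n) ∧ T ∈ completedWeyl K n ∧
    ∀ M : ℤ, ∃ s₀ : Finset ι, ∀ s : Finset ι, s₀ ⊆ s →
      T - ∑ i ∈ s, P i ∈ completedWeylGE K n M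

end AbhyankarGurjar

end

/-!
Write `∑_α (1/α!) ∂^α (H^α w) = S w`; the `α`-th term has order at least `o(w) + |α|`, so `S` is a
well-defined linear operator on `K[[z]]`. It is the pushforward of densities under `F = z - H`, and
two formal properties of a pushforward suffice.

* Since `[∂^α, z_i] = α_i ∂^(α - e_i)`, a shift of the summation index gives
  `S (F_i w) = z_i S w` (`sum_inversionTerm_mul`).
* Differentiating the terms and shifting indices gives
  `∑_j ∂_j S (∂_i F_j · w) = S (∂_i w)` (`sum_pderiv_sum_inversionTerm`). Applied to the entries of
  the `k`-th column of the adjugate of the Jacobian matrix and summed over `i`, the left side is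
  `∂_k S (𝒥F)`, while the right side vanishes by the Piola identity
  (`sum_derivation_adjugate`). Hence `S (𝒥F)` is constant, and the constant is `1`
  (`sum_inversionTerm_jacobian`).

Thus `T u = S (u 𝒥F)` satisfies `T 1 = 1` and `T (F_i u) = z_i T u`, so `T (p(F)) = p` for
polynomials, and by truncation for all power series (`map_subst_eq`). Moreover `T w - w` has order
larger than `w`, so `T` is injective. Therefore `T` is the two-sided inverse of the algebra
endomorphism `p ↦ p(F)`, the tuple `G_i = T z_i` is the inverse map of `F`, and every left inverse
`G` of `F` satisfies `u(G) = T u` (`isFormalInverse_map_X`, `subst_eq_of_comp_left`).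

For the convergence in the completed Weyl algebra, `∂^α z^β` is homogeneous of degree `|β| - |α|`,
and `H^α 𝒥F` has order at least `2|α|`; so the `α`-th operator only has components of degree at
least `|α|`, and each component of the sum is a finite sum (`mem_completedWeylGE`).
-/

noncomputable section

namespace AbhyankarGurjar

open MvPowerSeries

/-! ### Derivatives of determinants and the Piola identity -/

section Jacobian

variable {R A : Type*} [CommRing R] [CommRing A] [Algebra R A]

theorem derivation_prod {ι : Type*} [DecidableEq ι] (D : Derivation R A A) (s : Finset ι)
    (f : ι → A) : D (∏ i ∈ s, f i) = ∑ i ∈ s, (∏ j ∈ s.erase i, f j) * D (f i) := by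
  induction s using Finset.induction_on with
  | empty => simp
  | insert a s ha ih =>
    rw [Finset.prod_insert ha, D.leibniz, ih, Finset.sum_insert ha, Finset.erase_insert ha,
      smul_eq_mul, smul_eq_mul, add_comm, Finset.mul_sum]
    congr 1
    refine Finset.sum_congr rfl fun i hi => ?_
    have hia : a ≠ i := fun h => ha (h ▸ hi)
    rw [Finset.erase_insert_of_ne hia, Finset.prod_insert (by simp [ha]), mul_assoc]

theorem derivation_det {m : Type*} [Fintype m] [DecidableEq m] (D : Derivation R A A)
    (M : Matrix m m A) : D M.det = ∑ j, (M.updateRow j fun i => D (M j i)).det := by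
  have hcol : ∀ N : Matrix m m A, D N.det = ∑ j, (N.updateCol j fun i => D (N i j)).det := by
    intro N
    simp only [Matrix.det_apply, map_sum]
    rw [Finset.sum_comm]
    refine Finset.sum_congr rfl fun σ _ => ?_
    rw [Units.smul_def, map_zsmul, derivation_prod, ← Units.smul_def, Finset.smul_sum]
    refine Finset.sum_congr rfl fun j _ => ?_
    rw [← Finset.prod_erase_mul _ _ (Finset.mem_univ j)]
    congr 2
    · refine Finset.prod_congr rfl fun i hi => ?_
      rw [Matrix.updateCol_ne (Finset.ne_of_mem_erase hi)]
    · simp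
  rw [← Matrix.det_transpose, hcol]
  refine Finset.sum_congr rfl fun j _ => ?_
  rw [Matrix.updateCol_transpose, Matrix.det_transpose]
  rfl

theorem det_updateRow_eq_sum {m : Type*} [Fintype m] [DecidableEq m] (M : Matrix m m A) (j : m)
    (v : m → A) :
    (M.updateRow j v).det = ∑ l, v l * (M.updateRow j (Pi.single l 1)).det := by
  rw [Matrix.det_eq_sum_mul_adjugate_row _ j]
  simp [Matrix.adjugate_apply]

theorem det_updateRow_updateRow_swap {m : Type*} [Fintype m] [DecidableEq m] (M : Matrix m m A)
    {j k : m} (hjk : j ≠ k) (v w : m → A) :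
    ((M.updateRow k v).updateRow j w).det = -((M.updateRow k w).updateRow j v).det := by
  have h : (M.updateRow k v).updateRow j w =
      ((M.updateRow k w).updateRow j v).submatrix (Equiv.swap j k) id := by
    ext a b
    rw [Matrix.submatrix_apply]
    by_cases ha : a = j
    · subst ha
      simp [Matrix.updateRow_apply, hjk.symm]
    · by_cases hb : a = k
      · subst hb
        simp [Matrix.updateRow_apply, ha]
      · simp [Matrix.updateRow_apply, ha, hb, Equiv.swap_apply_of_ne_of_ne]
  rw [h, Matrix.det_permute, Equiv.Perm.sign_swap hjk]
  simp

/-- The Piola identity: the columns of the adjugate of a Jacobian matrix are divergence free. -/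
theorem sum_derivation_adjugate [IsAddTorsionFree A] {m : Type*} [Fintype m] [DecidableEq m]
    (D : m → Derivation R A A) (hD : ∀ i j a, D i (D j a) = D j (D i a)) (F : m → A) (k : m) :
    ∑ i, D i ((Matrix.of fun a b => D b (F a)).adjugate i k) = 0 := by
  set M : Matrix m m A := Matrix.of fun a b => D b (F a) with hM
  simp only [Matrix.adjugate_apply, derivation_det]
  rw [Finset.sum_comm]
  refine Finset.sum_eq_zero fun j _ => ?_
  by_cases hjk : j = k
  · refine Finset.sum_eq_zero fun i _ => Matrix.det_eq_zero_of_row_eq_zero j fun l => ?_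
    subst hjk
    by_cases hl : l = i
    · subst hl; simp
    · simp [hl]
  -- The sum over `i` is now the contraction of the symmetric array `∂_i ∂_l F_j` with an array
  -- which is alternating in `(i, l)`.
  rw [← self_eq_neg]
  calc _ = ∑ i, ∑ l, D i (D l (F j)) * ((M.updateRow k (Pi.single i 1)).updateRow j
          (Pi.single l 1)).det := by
        refine Finset.sum_congr rfl fun i _ => ?_
        rw [det_updateRow_eq_sum]
        simp [hjk, hM]
    _ = ∑ i, ∑ l, -(D l (D i (F j)) * ((M.updateRow k (Pi.single l 1)).updateRow j
          (Pi.single i 1)).det) := by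
        refine Finset.sum_congr rfl fun i _ => Finset.sum_congr rfl fun l _ => ?_
        rw [det_updateRow_updateRow_swap M hjk, hD, mul_neg]
    _ = _ := by
        rw [Finset.sum_comm]
        simp only [Finset.sum_neg_distrib, neg_inj]
        refine Finset.sum_congr rfl fun i _ => ?_
        rw [det_updateRow_eq_sum]
        simp [hjk, hM]

end Jacobian

/-! ### Multi-index powers, partial derivatives and orders -/

variable {K : Type*} [Field K] {n : ℕ}

theorem pderiv_comm (i j : Fin n) (f : MvPowerSeries (Fin n) K) :
    pderiv K i (pderiv K j f) = pderiv K j (pderiv K i f) := by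
  by_cases h : i = j
  · rw [h]
  ext d
  simp only [coeff_pderiv, Finsupp.add_apply, Finsupp.single_apply, h, Ne.symm h, if_false,
    add_zero, add_right_comm d]
  ring

theorem multiFactorial_add_single (α : Fin n →₀ ℕ) (i : Fin n) :
    multiFactorial (α + Finsupp.single i 1) = (α i + 1) * multiFactorial α := by
  unfold multiFactorial
  rw [← Finset.mul_prod_erase _ _ (Finset.mem_univ i),
    ← Finset.mul_prod_erase Finset.univ (fun i => (α i).factorial) (Finset.mem_univ i), ← mul_assoc]
  congr 1
  · simp [Nat.factorial_succ]
  · refine Finset.prod_congr rfl fun j hj => ?_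
    simp [(Finset.ne_of_mem_erase hj).symm]

theorem multiPow_add_single (H : Fin n → MvPowerSeries (Fin n) K) (α : Fin n →₀ ℕ) (i : Fin n) :
    multiPow H (α + Finsupp.single i 1) = multiPow H α * H i := by
  simp only [multiPow, Finsupp.add_apply, pow_add, Finset.prod_mul_distrib]
  congr 1
  rw [Finset.prod_eq_single i] <;> simp +contextual [eq_comm]

theorem partialPow_zero : partialPow (K := K) (0 : Fin n →₀ ℕ) = 1 := by
  simp [partialPow]

theorem partialPow_add_single (α : Fin n →₀ ℕ) (i : Fin n) (f : MvPowerSeries (Fin n) K) :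
    partialPow (α + Finsupp.single i 1) f = pderiv K i (partialPow α f) := by
  set D : Fin n → Module.End K (MvPowerSeries (Fin n) K) := fun i =>
    ((pderiv K i : Derivation K (MvPowerSeries (Fin n) K) (MvPowerSeries (Fin n) K)) :
      Module.End K (MvPowerSeries (Fin n) K)) with hD
  have hcomm : ∀ i j, Commute (D i) (D j) := fun i j =>
    LinearMap.ext fun f => pderiv_comm i j f
  have key : ∀ l : List (Fin n), l.Nodup →
      (l.map fun j => D j ^ (α + Finsupp.single i 1 : Fin n →₀ ℕ) j).prod =
        if i ∈ l then D i * (l.map fun j => D j ^ α j).prod else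
          (l.map fun j => D j ^ α j).prod := by
    intro l
    induction l with
    | nil => simp
    | cons a l ih =>
      intro hl
      rw [List.nodup_cons] at hl
      rw [List.map_cons, List.prod_cons, ih hl.2, List.map_cons, List.prod_cons]
      by_cases hia : i = a
      · subst hia
        simp [hl.1, pow_succ', mul_assoc]
      · by_cases hil : i ∈ l
        · simp only [hil, if_true, List.mem_cons, or_true, Finsupp.add_apply,
            Finsupp.single_apply, hia, if_false, add_zero]
          rw [← mul_assoc, ← mul_assoc, ((hcomm i a).pow_right _).eq]
        · simp [hil, hia]
  have := key (List.finRange n) (List.nodup_finRange n)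
  rw [if_pos (List.mem_finRange i)] at this
  exact congrArg (fun P : Module.End K (MvPowerSeries (Fin n) K) => P f) this

theorem finsupp_induction_add_single {p : (Fin n →₀ ℕ) → Prop} (h0 : p 0)
    (h1 : ∀ α i, p α → p (α + Finsupp.single i 1)) (α : Fin n →₀ ℕ) : p α := by
  induction hd : α.degree generalizing α with
  | zero => rw [Finsupp.degree_eq_zero_iff] at hd; rwa [hd]
  | succ d ih =>
    obtain ⟨i, hi⟩ : ∃ i, α i ≠ 0 := by
      by_contra! h
      have : α = 0 := Finsupp.ext h
      simp [this] at hd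
    have hle : Finsupp.single i 1 ≤ α := by
      simpa [Finsupp.single_le_iff, Nat.one_le_iff_ne_zero] using hi
    rw [← tsub_add_cancel_of_le hle] at hd ⊢
    refine h1 _ _ (ih _ ?_)
    simpa using hd

theorem partialPow_pderiv (α : Fin n →₀ ℕ) (i : Fin n) (f : MvPowerSeries (Fin n) K) :
    partialPow α (pderiv K i f) = pderiv K i (partialPow α f) := by
  induction α using finsupp_induction_add_single with
  | h0 => simp [partialPow_zero]
  | h1 α j ih => rw [partialPow_add_single, partialPow_add_single, ih, pderiv_comm]

/-- The commutation relation `[∂^α, z_i] = α_i ∂^(α - e_i)`. -/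
theorem partialPow_X_mul (α : Fin n →₀ ℕ) (i : Fin n) (f : MvPowerSeries (Fin n) K) :
    partialPow α (X i * f) =
      X i * partialPow α f + (α i : K) • partialPow (α - Finsupp.single i 1) f := by
  induction α using finsupp_induction_add_single with
  | h0 => simp [partialPow_zero]
  | h1 α j ih =>
    rw [partialPow_add_single, ih, map_add, Derivation.leibniz, partialPow_add_single,
      Derivation.map_smul, smul_eq_mul, smul_eq_mul]
    by_cases hij : i = j
    · subst hij
      rw [pderiv_X_self, mul_one, add_tsub_cancel_right, add_assoc]
      congr 1
      rw [← partialPow_add_single]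
      rcases Nat.eq_zero_or_pos (α i) with h | h
      · simp [h]
      · rw [tsub_add_cancel_of_le
          (by simpa [Finsupp.single_le_iff, Nat.one_le_iff_ne_zero] using h.ne')]
        simp [add_smul, add_comm]
    · rw [pderiv_X_of_ne hij, ← partialPow_add_single]
      have : α + Finsupp.single j 1 - Finsupp.single i 1 =
          α - Finsupp.single i 1 + Finsupp.single j 1 := by
        ext l
        simp only [Finsupp.tsub_apply, Finsupp.add_apply, Finsupp.single_apply]
        split_ifs <;> grind
      rw [this]
      simp [Ne.symm hij, partialPow_add_single]

theorem le_order_pderiv {k : ℕ} {f : MvPowerSeries (Fin n) K} (i : Fin n)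
    (hf : ((k + 1 : ℕ) : ℕ∞) ≤ f.order) : (k : ℕ∞) ≤ (pderiv K i f).order := by
  refine nat_le_order fun d hd => ?_
  rw [coeff_pderiv, coeff_of_lt_order, zero_mul]
  refine lt_of_lt_of_le ?_ hf
  simpa using hd

theorem le_order_partialPow {k : ℕ} {f : MvPowerSeries (Fin n) K} (α : Fin n →₀ ℕ)
    (hf : ((k + α.degree : ℕ) : ℕ∞) ≤ f.order) : (k : ℕ∞) ≤ (partialPow α f).order := by
  induction α using finsupp_induction_add_single generalizing k with
  | h0 => simpa [partialPow_zero] using hf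
  | h1 α i ih =>
    rw [partialPow_add_single]
    refine le_order_pderiv i (ih (hf.trans' (Nat.cast_le.mpr ?_)))
    rw [map_add, Finsupp.degree_single, add_assoc, add_comm 1]

theorem le_order_mul_of_le {k l : ℕ} {f g : MvPowerSeries (Fin n) K} (hf : (k : ℕ∞) ≤ f.order)
    (hg : (l : ℕ∞) ≤ g.order) : ((k + l : ℕ) : ℕ∞) ≤ (f * g).order := by
  push_cast
  exact (add_le_add hf hg).trans le_order_mul

theorem le_order_sub_of_le {k : ℕ∞} {f g : MvPowerSeries (Fin n) K} (hf : k ≤ f.order)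
    (hg : k ≤ g.order) : k ≤ (f - g).order := by
  rw [sub_eq_add_neg]
  exact (le_min hf (by rwa [order_neg])).trans min_order_le_add

theorem le_order_multiPow {H : Fin n → MvPowerSeries (Fin n) K} (hH : 2 ≤ tupleOrder H)
    (α : Fin n →₀ ℕ) : ((2 * α.degree : ℕ) : ℕ∞) ≤ (multiPow H α).order := by
  induction α using finsupp_induction_add_single with
  | h0 => simp
  | h1 α i ih =>
    rw [multiPow_add_single, map_add, Finsupp.degree_single, mul_add]
    exact le_order_mul_of_le ih (hH.trans (iInf_le _ i))

theorem pderiv_multiPow (H : Fin n → MvPowerSeries (Fin n) K) (α : Fin n →₀ ℕ) (i : Fin n) :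
    pderiv K i (multiPow H α) =
      ∑ j, (α j : K) • (multiPow H (α - Finsupp.single j 1) * pderiv K i (H j)) := by
  unfold multiPow
  rw [derivation_prod]
  refine Finset.sum_congr rfl fun j _ => ?_
  rw [pderiv_pow, ← Finset.mul_prod_erase _ _ (Finset.mem_univ j)]
  have : ∏ l ∈ Finset.univ.erase j, H l ^ (α - Finsupp.single j 1 : Fin n →₀ ℕ) l =
      ∏ l ∈ Finset.univ.erase j, H l ^ α l := by
    refine Finset.prod_congr rfl fun l hl => ?_
    simp [(Finset.ne_of_mem_erase hl).symm]
  rw [this, Nat.cast_smul_eq_nsmul, nsmul_eq_mul]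
  simp
  ring

/-! ### Formal sums -/

section FormalHasSum

variable {ι : Type*} {f g : ι → MvPowerSeries (Fin n) K} {s t : MvPowerSeries (Fin n) K}

theorem formalHasSum_iff_coeff : FormalHasSum f s ↔ ∀ d : Fin n →₀ ℕ,
    letI : TopologicalSpace K := ⊥
    HasSum (fun i => coeff d (f i)) (coeff d s) := by
  let : TopologicalSpace K := ⊥
  exact WithPiTopology.hasSum_iff_hasSum_coeff

/-- A family is summable as soon as each coefficient involves only finitely many members; the
finite sets may be chosen in any way. -/
theorem formalHasSum_of_finset (F : (Fin n →₀ ℕ) → Finset ι)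
    (h0 : ∀ d, ∀ i ∉ F d, coeff d (f i) = 0) (h : ∀ d, ∑ i ∈ F d, coeff d (f i) = coeff d s) :
    FormalHasSum f s := by
  rw [formalHasSum_iff_coeff]
  intro d
  let : TopologicalSpace K := ⊥
  rw [← h d]
  exact hasSum_sum_of_ne_finset_zero (h0 d)

theorem FormalHasSum.unique (hs : FormalHasSum f s) (ht : FormalHasSum f t) : s = t := by
  rw [formalHasSum_iff_coeff] at hs ht
  let : TopologicalSpace K := ⊥
  have : DiscreteTopology K := ⟨rfl⟩
  ext d
  exact (hs d).unique (ht d)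

theorem FormalHasSum.coeff_eq_sum (hs : FormalHasSum f s) (d : Fin n →₀ ℕ) (F : Finset ι)
    (h0 : ∀ i ∉ F, coeff d (f i) = 0) : coeff d s = ∑ i ∈ F, coeff d (f i) := by
  rw [formalHasSum_iff_coeff] at hs
  let : TopologicalSpace K := ⊥
  have : DiscreteTopology K := ⟨rfl⟩
  exact (hs d).unique (hasSum_sum_of_ne_finset_zero h0)

theorem FormalHasSum.add (hs : FormalHasSum f s) (ht : FormalHasSum g t) :
    FormalHasSum (fun i => f i + g i) (s + t) := by
  rw [formalHasSum_iff_coeff] at *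
  intro d
  let : TopologicalSpace K := ⊥
  have : DiscreteTopology K := ⟨rfl⟩
  simpa using (hs d).add (ht d)

theorem FormalHasSum.sub (hs : FormalHasSum f s) (ht : FormalHasSum g t) :
    FormalHasSum (fun i => f i - g i) (s - t) := by
  rw [formalHasSum_iff_coeff] at *
  intro d
  let : TopologicalSpace K := ⊥
  have : DiscreteTopology K := ⟨rfl⟩
  simpa using (hs d).sub (ht d)

theorem FormalHasSum.sum {κ : Type*} {f : κ → ι → MvPowerSeries (Fin n) K}
    {s : κ → MvPowerSeries (Fin n) K} (J : Finset κ) (hs : ∀ j ∈ J, FormalHasSum (f j) (s j)) :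
    FormalHasSum (fun i => ∑ j ∈ J, f j i) (∑ j ∈ J, s j) := by
  simp only [formalHasSum_iff_coeff] at *
  intro d
  let : TopologicalSpace K := ⊥
  have : DiscreteTopology K := ⟨rfl⟩
  simpa using hasSum_sum fun j hj => hs j hj d

theorem FormalHasSum.mul_left (h : MvPowerSeries (Fin n) K) (hs : FormalHasSum f s) :
    FormalHasSum (fun i => h * f i) (h * s) := by
  let : TopologicalSpace K := ⊥
  have : DiscreteTopology K := ⟨rfl⟩
  let : TopologicalSpace (MvPowerSeries (Fin n) K) := WithPiTopology.instTopologicalSpace K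
  have : IsTopologicalSemiring (MvPowerSeries (Fin n) K) :=
    WithPiTopology.instIsTopologicalSemiring (Fin n) K
  exact HasSum.mul_left h hs

theorem FormalHasSum.pderiv (i : Fin n) (hs : FormalHasSum f s) :
    FormalHasSum (fun j => pderiv K i (f j)) (pderiv K i s) := by
  rw [formalHasSum_iff_coeff] at *
  intro d
  let : TopologicalSpace K := ⊥
  have : DiscreteTopology K := ⟨rfl⟩
  simpa only [coeff_pderiv] using (hs _).mul_right _

/-- Reindexing by `α ↦ α + e_j`, the new family being extended by zero to the exponents outside
the image. -/
theorem FormalHasSum.shift {f : (Fin n →₀ ℕ) → MvPowerSeries (Fin n) K} (j : Fin n)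
    (hs : FormalHasSum f s) :
    FormalHasSum (fun α => if α j = 0 then 0 else f (α - Finsupp.single j 1)) s := by
  have hinj : Function.Injective fun α : Fin n →₀ ℕ => α + Finsupp.single j 1 :=
    add_left_injective _
  rw [formalHasSum_iff_coeff] at *
  intro d
  let : TopologicalSpace K := ⊥
  have : DiscreteTopology K := ⟨rfl⟩
  rw [← hinj.hasSum_iff]
  · simpa [Function.comp_def] using hs d
  · intro α hα
    by_cases h : α j = 0
    · simp [h]
    · refine absurd ⟨α - Finsupp.single j 1, ?_⟩ hα
      exact tsub_add_cancel_of_le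
        (by simpa [Finsupp.single_le_iff, Nat.one_le_iff_ne_zero] using h)

end FormalHasSum

/-- The finite set of exponents of degree at most `k`. -/
def degreeLE (n k : ℕ) : Finset (Fin n →₀ ℕ) :=
  (Finsupp.finite_of_degree_le k).toFinset

@[simp]
theorem mem_degreeLE {k : ℕ} {α : Fin n →₀ ℕ} : α ∈ degreeLE n k ↔ α.degree ≤ k := by
  simp [degreeLE]

/-- A family of operators can be summed pointwise if the `α`-th one takes values of order at least
`|α|`. -/
theorem exists_operator_sum (P : (Fin n →₀ ℕ) → Module.End K (MvPowerSeries (Fin n) K))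
    (hP : ∀ α f, (α.degree : ℕ∞) ≤ (P α f).order) :
    ∃ S : Module.End K (MvPowerSeries (Fin n) K), ∀ f, FormalHasSum (fun α => P α f) (S f) := by
  refine ⟨{ toFun := fun f d => ∑ α ∈ degreeLE n d.degree, coeff d (P α f)
            map_add' := fun f g => ?_
            map_smul' := fun c f => ?_ }, fun f => ?_⟩
  · funext d
    simp only [map_add, Finset.sum_add_distrib]
    rfl
  · funext d
    simp only [map_smul, ← Finset.smul_sum]
    rfl
  · refine formalHasSum_of_finset (fun d => degreeLE n d.degree) (fun d α hα => ?_)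
      fun d => rfl
    rw [mem_degreeLE, not_le] at hα
    exact coeff_of_lt_order ((Nat.cast_lt.mpr hα).trans_le (hP α f))

theorem FormalHasSum.le_order {ι : Type*} {f : ι → MvPowerSeries (Fin n) K}
    {s : MvPowerSeries (Fin n) K} {k : ℕ∞} (hs : FormalHasSum f s) (h : ∀ i, k ≤ (f i).order) :
    k ≤ s.order := by
  refine MvPowerSeries.le_order fun d hd => ?_
  rw [hs.coeff_eq_sum d ∅ fun i _ => coeff_of_lt_order (hd.trans_le (h i)), Finset.sum_empty]

/-! ### The pushforward of densities -/

/-- The operator `w ↦ (1/α!) ∂^α (H^α w)`. -/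
def inversionTerm (H : Fin n → MvPowerSeries (Fin n) K) (α : Fin n →₀ ℕ) :
    Module.End K (MvPowerSeries (Fin n) K) :=
  (multiFactorial α : K)⁻¹ • (partialPow α * mulOp (multiPow H α))

theorem inversionTerm_apply (H : Fin n → MvPowerSeries (Fin n) K) (α : Fin n →₀ ℕ)
    (w : MvPowerSeries (Fin n) K) :
    inversionTerm H α w = (multiFactorial α : K)⁻¹ • partialPow α (multiPow H α * w) := rfl

theorem le_order_inversionTerm {H : Fin n → MvPowerSeries (Fin n) K} (hH : 2 ≤ tupleOrder H)
    (α : Fin n →₀ ℕ) {k : ℕ} {w : MvPowerSeries (Fin n) K} (hw : (k : ℕ∞) ≤ w.order) :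
    ((k + α.degree : ℕ) : ℕ∞) ≤ (inversionTerm H α w).order := by
  rw [inversionTerm_apply]
  refine (le_order_partialPow α ?_).trans le_order_smul
  refine (Nat.cast_le.mpr ?_).trans (le_order_mul_of_le (le_order_multiPow hH α) hw)
  omega

theorem multiFactorial_cast_mul_inv [CharZero K] (α : Fin n →₀ ℕ) (i : Fin n) (hi : α i ≠ 0) :
    (multiFactorial α : K)⁻¹ * (α i : K) = (multiFactorial (α - Finsupp.single i 1) : K)⁻¹ := by
  have hle : Finsupp.single i 1 ≤ α := by
    simpa [Finsupp.single_le_iff, Nat.one_le_iff_ne_zero] using hi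
  obtain ⟨β, rfl⟩ : ∃ β, α = β + Finsupp.single i 1 := ⟨_, (tsub_add_cancel_of_le hle).symm⟩
  have h0 : (multiFactorial β : K) ≠ 0 := by
    simp [multiFactorial, Finset.prod_eq_zero_iff, Nat.factorial_ne_zero]
  have h1 : ((β i : K) + 1) ≠ 0 := Nat.cast_add_one_ne_zero _
  rw [add_tsub_cancel_right, multiFactorial_add_single]
  simp only [Finsupp.single_eq_same, Finsupp.add_apply, Nat.cast_add, Nat.cast_one, Nat.cast_mul]
  field_simp

theorem multiPow_tsub_single (H : Fin n → MvPowerSeries (Fin n) K) (α : Fin n →₀ ℕ) (i : Fin n)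
    (hi : α i ≠ 0) : multiPow H α = multiPow H (α - Finsupp.single i 1) * H i := by
  rw [← multiPow_add_single, tsub_add_cancel_of_le]
  simpa [Finsupp.single_le_iff, Nat.one_le_iff_ne_zero] using hi

/-- The defect of `z_i`-linearity of a term is a term of lower index, so it telescopes in the sum
over `α`. -/
theorem inversionTerm_X_mul [CharZero K] (H : Fin n → MvPowerSeries (Fin n) K) (α : Fin n →₀ ℕ)
    (i : Fin n) (w : MvPowerSeries (Fin n) K) :
    inversionTerm H α (X i * w) = X i * inversionTerm H α w +
      if α i = 0 then 0 else inversionTerm H (α - Finsupp.single i 1) (H i * w) := by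
  rw [inversionTerm_apply, mul_left_comm, partialPow_X_mul, smul_add, inversionTerm_apply,
    mul_smul_comm]
  congr 1
  split_ifs with h
  · simp [h]
  · rw [smul_smul, multiFactorial_cast_mul_inv α i h, multiPow_tsub_single H α i h, mul_assoc,
      inversionTerm_apply]

/-- The term arising when the derivative falls on the factor `H_j` of `H^α` has index `α - e_j`. -/
theorem pderiv_inversionTerm [CharZero K] (H : Fin n → MvPowerSeries (Fin n) K)
    (α : Fin n →₀ ℕ) (i : Fin n) (w : MvPowerSeries (Fin n) K) :
    pderiv K i (inversionTerm H α w) = inversionTerm H α (pderiv K i w) +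
      ∑ j, if α j = 0 then 0 else
        pderiv K j (inversionTerm H (α - Finsupp.single j 1) (pderiv K i (H j) * w)) := by
  rw [inversionTerm_apply, Derivation.map_smul, ← partialPow_pderiv, Derivation.leibniz, map_add,
    smul_add, smul_eq_mul, smul_eq_mul, inversionTerm_apply]
  congr 1
  rw [pderiv_multiPow, Finset.mul_sum, map_sum, Finset.smul_sum]
  refine Finset.sum_congr rfl fun j _ => ?_
  split_ifs with h
  · simp [h]
  · rw [mul_smul_comm, map_smul, smul_smul, multiFactorial_cast_mul_inv α j h,
      inversionTerm_apply, Derivation.map_smul, ← partialPow_add_single, tsub_add_cancel_of_le]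
    · congr 2
      ring
    · simpa [Finsupp.single_le_iff, Nat.one_le_iff_ne_zero] using h

section Pushforward

variable {H : Fin n → MvPowerSeries (Fin n) K}
  {S : Module.End K (MvPowerSeries (Fin n) K)}

/-- `S` intertwines multiplication by `F_i = z_i - H_i` with multiplication by `z_i`. -/
theorem sum_inversionTerm_mul [CharZero K]
    (hS : ∀ w, FormalHasSum (fun α => inversionTerm H α w) (S w)) (i : Fin n)
    (w : MvPowerSeries (Fin n) K) : S ((X i - H i) * w) = X i * S w := by
  rw [sub_mul, map_sub, sub_eq_iff_eq_add]
  refine (hS (X i * w)).unique ?_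
  simp only [inversionTerm_X_mul]
  exact ((hS w).mul_left (X i)).add ((hS (H i * w)).shift i)

theorem pderiv_sum_inversionTerm [CharZero K]
    (hS : ∀ w, FormalHasSum (fun α => inversionTerm H α w) (S w)) (i : Fin n)
    (w : MvPowerSeries (Fin n) K) :
    pderiv K i (S w) = S (pderiv K i w) + ∑ j, pderiv K j (S (pderiv K i (H j) * w)) := by
  refine ((hS w).pderiv i).unique ?_
  simp_rw +singlePass [pderiv_inversionTerm H]
  exact (hS _).add (FormalHasSum.sum _ fun j _ => ((hS _).pderiv j).shift j)

/-- `S` pushes forward densities along `F = z - H`, so it turns a divergence into a divergence. -/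
theorem sum_pderiv_sum_inversionTerm [CharZero K]
    (hS : ∀ w, FormalHasSum (fun α => inversionTerm H α w) (S w)) (i : Fin n)
    (w : MvPowerSeries (Fin n) K) :
    ∑ j, pderiv K j (S (pderiv K i (X j - H j) * w)) = S (pderiv K i w) := by
  have h := pderiv_sum_inversionTerm hS i w
  simp only [map_sub, sub_mul, Finset.sum_sub_distrib]
  rw [sub_eq_iff_eq_add, ← h]
  simp only [pderiv_X, Pi.single_apply]
  rw [Finset.sum_eq_single i] <;> simp +contextual

/-- `S` is the identity up to terms of higher order. -/
theorem le_order_sum_inversionTerm_sub (hH : 2 ≤ tupleOrder H)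
    (hS : ∀ w, FormalHasSum (fun α => inversionTerm H α w) (S w)) {k : ℕ}
    {w : MvPowerSeries (Fin n) K} (hw : (k : ℕ∞) ≤ w.order) :
    ((k + 1 : ℕ) : ℕ∞) ≤ (S w - w).order := by
  classical
  -- The term `α = 0` of the sum is `w` itself, and all other terms have larger order.
  have hw0 : FormalHasSum (fun α : Fin n →₀ ℕ => if α = 0 then w else 0) w :=
    formalHasSum_of_finset (fun _ => {0}) (fun d α hα => by simp_all) (by simp)
  refine ((hS w).sub hw0).le_order fun α => ?_
  by_cases hα : α = 0
  · subst hα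
    simp [inversionTerm_apply, multiFactorial, partialPow_zero, multiPow]
  · rw [if_neg hα, sub_zero]
    refine (Nat.cast_le.mpr ?_).trans (le_order_inversionTerm hH α hw)
    have : α.degree ≠ 0 := by rwa [Ne, Finsupp.degree_eq_zero_iff]
    omega

theorem constantCoeff_jacobian (hH : 2 ≤ tupleOrder H) :
    constantCoeff (jacobian fun i => X i - H i) = 1 := by
  rw [jacobian, RingHom.map_det]
  convert! Matrix.det_one (n := Fin n) (R := K)
  ext i j
  have : constantCoeff (pderiv K j (H i)) = 0 := by
    rw [← one_le_order_iff_constCoeff_eq_zero]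
    exact le_order_pderiv (k := 1) j (hH.trans (iInf_le _ i))
  simp [this, pderiv_X, Pi.single_apply, Matrix.one_apply, apply_ite]

theorem one_le_order_jacobian_sub_one (hH : 2 ≤ tupleOrder H) :
    1 ≤ ((jacobian fun i => X i - H i) - 1).order := by
  rw [one_le_order_iff_constCoeff_eq_zero, map_sub, constantCoeff_jacobian hH, map_one, sub_self]

/-- The pushforward of the density `𝒥F` is `1`. -/
theorem sum_inversionTerm_jacobian [CharZero K] (hH : 2 ≤ tupleOrder H)
    (hS : ∀ w, FormalHasSum (fun α => inversionTerm H α w) (S w)) :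
    S (jacobian fun i => X i - H i) = 1 := by
  set F : Fin n → MvPowerSeries (Fin n) K := fun i => X i - H i with hF
  set M := Matrix.of fun i j => pderiv K j (F i) with hM
  have : IsAddTorsionFree (MvPowerSeries (Fin n) K) :=
    inferInstanceAs (IsAddTorsionFree ((Fin n →₀ ℕ) → K))
  refine pderiv.ext (fun k => ?_) ?_
  · rw [pderiv_one]
    -- The `k`-th column of the adjugate is divergence free, and `F` maps it to `𝒥F • ∂_k`.
    have hmul : ∀ j, ∑ i, pderiv K i (F j) * M.adjugate i k = if j = k then jacobian F else 0 := by
      intro j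
      have := congrFun (congrFun (Matrix.mul_adjugate M) j) k
      rw [Matrix.mul_apply] at this
      simpa [Matrix.one_apply, hM, jacobian] using this
    calc pderiv K k (S (jacobian F))
        = ∑ j, pderiv K j (S (∑ i, pderiv K i (F j) * M.adjugate i k)) := by
          simp_rw [hmul]
          rw [Finset.sum_eq_single k] <;> simp +contextual
      _ = ∑ i, ∑ j, pderiv K j (S (pderiv K i (F j) * M.adjugate i k)) := by
          simp only [map_sum]
          exact Finset.sum_comm
      _ = S (∑ i, pderiv K i (M.adjugate i k)) := by
          rw [map_sum]
          exact Finset.sum_congr rfl fun i _ => sum_pderiv_sum_inversionTerm hS i _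
      _ = 0 := by
          rw [sum_derivation_adjugate (fun i => pderiv K i) pderiv_comm F k, map_zero]
  · have h := le_order_sum_inversionTerm_sub hH hS (k := 0) (w := jacobian F) (by simp)
    rw [zero_add, Nat.cast_one, one_le_order_iff_constCoeff_eq_zero, map_sub,
      constantCoeff_jacobian hH, sub_eq_zero] at h
    rw [h, map_one]

end Pushforward

/-! ### Inverting the substitution -/

section LeftInverse

variable {F : Fin n → MvPowerSeries (Fin n) K}
  {T : Module.End K (MvPowerSeries (Fin n) K)}

theorem map_aeval_eq_coe (hmul : ∀ i w, T (F i * w) = X i * T w) (hone : T 1 = 1)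
    (q : MvPolynomial (Fin n) K) : T (MvPolynomial.aeval F q) = q := by
  induction q using MvPolynomial.induction_on with
  | C a =>
    rw [MvPolynomial.aeval_C, Algebra.algebraMap_eq_smul_one, map_smul, hone, MvPolynomial.coe_C,
      smul_eq_C_mul, mul_one]
  | add p q hp hq => simp [hp, hq]
  | mul_X p i hp =>
    rw [map_mul, MvPolynomial.aeval_X, mul_comm, hmul, hp, MvPolynomial.coe_mul,
      MvPolynomial.coe_X, mul_comm]

theorem le_order_map_of_sub (hT : ∀ (k : ℕ) w, (k : ℕ∞) ≤ w.order →
      ((k + 1 : ℕ) : ℕ∞) ≤ (T w - w).order) {k : ℕ}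
    {w : MvPowerSeries (Fin n) K} (hw : (k : ℕ∞) ≤ w.order) : (k : ℕ∞) ≤ (T w).order := by
  rw [← sub_add_cancel (T w) w]
  exact (le_min ((Nat.cast_le.mpr k.le_succ).trans (hT k w hw)) hw).trans min_order_le_add

theorem le_order_subst_of_le (hF : ∀ i, constantCoeff (F i) = 0) {k : ℕ∞}
    {p : MvPowerSeries (Fin n) K} (hp : k ≤ p.order) : k ≤ (subst F p).order := by
  refine hp.trans ((?_ : _ ≤ _).trans
    (le_order_subst (hasSubst_of_constantCoeff_zero hF) p))
  have h1 : 1 ≤ ⨅ i, (F i).order := le_iInf fun i => one_le_order_iff_constCoeff_eq_zero.mpr (hF i)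
  simpa using mul_le_mul_left h1 p.order

theorem eq_of_forall_nat_le_order_sub {f g : MvPowerSeries (Fin n) K}
    (h : ∀ k : ℕ, (k : ℕ∞) ≤ (f - g).order) : f = g := by
  rw [← sub_eq_zero, ← order_eq_top_iff]
  exact ENat.eq_top_iff_forall_ge.mpr h

/-- An operator which turns multiplication by `F_i` into multiplication by `z_i` inverts the
substitution of `F` on polynomials. If it does not lower orders, comparison with truncations extends
this to all power series. -/
theorem map_subst_eq (hF : ∀ i, constantCoeff (F i) = 0)
    (hmul : ∀ i w, T (F i * w) = X i * T w) (hone : T 1 = 1)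
    (hT : ∀ (k : ℕ) w, (k : ℕ∞) ≤ w.order → ((k + 1 : ℕ) : ℕ∞) ≤ (T w - w).order)
    (p : MvPowerSeries (Fin n) K) : T (subst F p) = p := by
  refine eq_of_forall_nat_le_order_sub fun k => ?_
  have hFs := hasSubst_of_constantCoeff_zero hF
  set q := truncTotal k p with hq
  have hr : (k : ℕ∞) ≤ (p - (q : MvPowerSeries (Fin n) K)).order := by
    refine nat_le_order fun d hd => ?_
    rw [map_sub, MvPolynomial.coeff_coe, hq, coeff_truncTotal _ hd, sub_self]
  have hsplit : T (subst F p) - p =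
      T (subst F (p - (q : MvPowerSeries (Fin n) K))) - (p - (q : MvPowerSeries (Fin n) K)) := by
    rw [subst_sub hFs, map_sub, subst_coe, map_aeval_eq_coe hmul hone]
    ring
  rw [hsplit]
  exact le_order_sub_of_le (le_order_map_of_sub hT (le_order_subst_of_le hF hr)) hr

theorem injective_of_le_order_sub
    (hT : ∀ (k : ℕ) w, (k : ℕ∞) ≤ w.order → ((k + 1 : ℕ) : ℕ∞) ≤ (T w - w).order) :
    Function.Injective T := by
  rw [injective_iff_map_eq_zero]
  intro w hw
  refine eq_of_forall_nat_le_order_sub fun k => ?_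
  rw [sub_zero]
  induction k with
  | zero => simp
  | succ k ih => simpa [hw] using hT k w ih

/-- A left inverse of the substitution of `F` agrees with the substitution of any `G` such that
`G(F(z)) = z`. -/
theorem subst_eq_of_comp_left {G : Fin n → MvPowerSeries (Fin n) K}
    (hF : ∀ i, constantCoeff (F i) = 0) (hG : ∀ i, constantCoeff (G i) = 0)
    (hFT : ∀ p, T (subst F p) = p) (hGF : ∀ i, subst F (G i) = X i)
    (u : MvPowerSeries (Fin n) K) : T u = subst G u := by
  have h : subst F (subst G u) = u := by
    rw [subst_comp_subst_apply (hasSubst_of_constantCoeff_zero hG)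
      (hasSubst_of_constantCoeff_zero hF)]
    simp only [hGF]
    exact congrFun (subst_self (σ := Fin n) (R := K)) u
  rw [← hFT (subst G u), h]

/-- If a left inverse `T` of the substitution of `F` is the identity up to terms of higher order, it
is injective, hence the two-sided inverse and so the substitution of the tuple `T z_1, …, T z_n`,
which is therefore the inverse map of `F`. -/
theorem isFormalInverse_map_X (hF : ∀ i, constantCoeff (F i) = 0)
    (hFT : ∀ p, T (subst F p) = p)
    (hT : ∀ (k : ℕ) w, (k : ℕ∞) ≤ w.order → ((k + 1 : ℕ) : ℕ∞) ≤ (T w - w).order) :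
    IsFormalInverse F fun i => T (X i) := by
  have hG : ∀ i, constantCoeff (T (X i)) = 0 := fun i => by
    rw [← one_le_order_iff_constCoeff_eq_zero]
    refine le_order_map_of_sub (k := 1) hT ?_
    rw [Nat.cast_one, one_le_order_iff_constCoeff_eq_zero, constantCoeff_X]
  have hGF : ∀ i, subst F (T (X i)) = X i := fun i =>
    injective_of_le_order_sub hT (hFT _)
  refine ⟨hG, fun i => ?_, hGF⟩
  rw [← subst_eq_of_comp_left hF hG hFT hGF,
    ← subst_X (R := K) (hasSubst_of_constantCoeff_zero hF) i, hFT]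

end LeftInverse

/-! ### Homogeneous components in the Weyl algebra -/

theorem mulOp_apply (h f : MvPowerSeries (Fin n) K) : mulOp h f = h * f := rfl

theorem pderiv_monomial (i : Fin n) (β : Fin n →₀ ℕ) (a : K) :
    pderiv K i (monomial β a) = monomial (β - Finsupp.single i 1) (a * β i) := by
  rw [← MvPolynomial.coe_monomial, pderiv_coe, MvPolynomial.pderiv_monomial,
    MvPolynomial.coe_monomial]

/-- The grading is multiplicative for left multiplication by `∂^α`, because moving `∂_i` past `z^β`
produces `β_i z^(β - e_i)`. -/
theorem partialPow_mul_mem_weylHomogeneous (α : Fin n →₀ ℕ) {m : ℤ}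
    {P : Module.End K (MvPowerSeries (Fin n) K)} (hP : P ∈ weylHomogeneous K n m) :
    partialPow α * P ∈ weylHomogeneous K n (m - α.degree) := by
  have step : ∀ (i : Fin n) (m : ℤ) (P : Module.End K (MvPowerSeries (Fin n) K)),
      P ∈ weylHomogeneous K n m →
      (pderiv K i : Module.End K (MvPowerSeries (Fin n) K)) * P ∈
        weylHomogeneous K n (m - 1) := by
    intro i m P hP
    induction hP using Submodule.span_induction with
    | mem P hP =>
      obtain ⟨α, β, rfl, rfl⟩ := hP
      have h : (pderiv K i : Module.End K (MvPowerSeries (Fin n) K)) *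
          (mulOp (monomial β 1) * partialPow α) =
          mulOp (monomial β 1) * partialPow (α + Finsupp.single i 1) +
            (β i : K) • (mulOp (monomial (β - Finsupp.single i 1) 1) * partialPow α) := by
        refine LinearMap.ext fun f => ?_
        have hmon : (monomial (β - Finsupp.single i 1) ((β i : K)) : MvPowerSeries (Fin n) K) =
            (β i : K) • monomial (β - Finsupp.single i 1) 1 := by
          rw [← map_smul, smul_eq_mul, mul_one]
        change pderiv K i (monomial β 1 * partialPow α f) =
          monomial β 1 * partialPow (α + Finsupp.single i 1) f +
            (β i : K) • (monomial (β - Finsupp.single i 1) 1 * partialPow α f)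
        rw [Derivation.leibniz, partialPow_add_single, pderiv_monomial, one_mul, hmon,
          smul_eq_mul, smul_eq_mul, mul_smul_comm, mul_comm (partialPow α f)]
      rw [h]
      refine Submodule.add_mem _ (Submodule.subset_span ⟨_, _, ?_, rfl⟩) ?_
      · rw [map_add, Finsupp.degree_single]
        push_cast
        ring
      · by_cases hβ : β i = 0
        · simp [hβ]
        · refine Submodule.smul_mem _ _ (Submodule.subset_span ⟨_, _, ?_, rfl⟩)
          have hle : Finsupp.single i 1 ≤ β := by
            simpa [Finsupp.single_le_iff, Nat.one_le_iff_ne_zero] using hβ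
          conv_rhs => rw [← tsub_add_cancel_of_le hle, map_add, Finsupp.degree_single]
          push_cast
          ring
    | zero => simp
    | add P Q _ _ hP hQ => rw [mul_add]; exact Submodule.add_mem _ hP hQ
    | smul c P _ hP => rw [mul_smul_comm]; exact Submodule.smul_mem _ _ hP
  induction α using finsupp_induction_add_single with
  | h0 => simpa [partialPow_zero] using hP
  | h1 α i ih =>
    have h : partialPow (α + Finsupp.single i 1) * P =
        (pderiv K i : Module.End K (MvPowerSeries (Fin n) K)) * (partialPow α * P) :=
      LinearMap.ext fun f => partialPow_add_single α i (P f)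
    rw [h, map_add, Finsupp.degree_single, Nat.cast_add, Nat.cast_one, ← sub_sub]
    exact step i _ _ ih

theorem mulOp_homogeneousComponent_mem (p : ℕ) (h : MvPowerSeries (Fin n) K) :
    mulOp (homogeneousComponent p h) ∈ weylHomogeneous K n p := by
  have hsum : mulOp (homogeneousComponent p h) =
      ∑ β ∈ (degreeLE n p).filter (fun β => β.degree = p),
        coeff β h • (mulOp (monomial β 1) * partialPow 0) := by
    have : homogeneousComponent p h = ∑ β ∈ (degreeLE n p).filter (fun β => β.degree = p),
        coeff β h • monomial β 1 := by
      classical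
      ext d
      rw [coeff_homogeneousComponent]
      simp only [map_sum, map_smul, coeff_monomial, smul_eq_mul, mul_ite, mul_one, mul_zero,
        Finset.sum_ite_eq, Finset.mem_filter, mem_degreeLE]
      exact if_congr ⟨fun hd => ⟨hd.le, hd⟩, And.right⟩ rfl rfl
    refine LinearMap.ext fun f => ?_
    simp [mulOp_apply, this, partialPow_zero, Finset.sum_mul, LinearMap.sum_apply]
  rw [hsum]
  refine Submodule.sum_mem _ fun β hβ => Submodule.smul_mem _ _
    (Submodule.subset_span ⟨0, β, ?_, rfl⟩)
  simpa using (Finset.mem_filter.mp hβ).2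

/-- The component in `D_m` of the operator `w ↦ ∂^α (h w)`: it comes from the homogeneous component
of `h` of degree `m + |α|`, which is zero when `m + |α|` is negative. -/
def weylComponent (α : Fin n →₀ ℕ) (h : MvPowerSeries (Fin n) K) (m : ℤ) :
    Module.End K (MvPowerSeries (Fin n) K) :=
  if 0 ≤ m + α.degree then
    partialPow α * mulOp (homogeneousComponent (m + α.degree).toNat h)
  else 0

theorem weylComponent_mem (α : Fin n →₀ ℕ) (h : MvPowerSeries (Fin n) K) (m : ℤ) :
    weylComponent α h m ∈ weylHomogeneous K n m := by
  unfold weylComponent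
  split_ifs with hm
  · have := partialPow_mul_mem_weylHomogeneous α
      (mulOp_homogeneousComponent_mem (m + α.degree).toNat h)
    rwa [Int.toNat_of_nonneg hm, add_sub_cancel_right] at this
  · exact Submodule.zero_mem _

theorem weylComponent_eq_zero {α : Fin n →₀ ℕ} {h : MvPowerSeries (Fin n) K}
    (hh : ((2 * α.degree : ℕ) : ℕ∞) ≤ h.order) {m : ℤ} (hm : m < α.degree) :
    weylComponent α h m = 0 := by
  unfold weylComponent
  split_ifs with h0
  · rw [homogeneousComponent_of_lt_order_eq_zero]
    · exact LinearMap.ext fun f => by simp [mulOp_apply]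
    · refine lt_of_lt_of_le (Nat.cast_lt.mpr ?_) hh
      omega
  · rfl

theorem coeff_weylComponent_eq_zero (α : Fin n →₀ ℕ) (h f : MvPowerSeries (Fin n) K) {m : ℤ}
    {d : Fin n →₀ ℕ} (hd : d.degree < m) : coeff d (weylComponent α h m f) = 0 := by
  have hm : 0 ≤ m + α.degree := by omega
  rw [weylComponent, if_pos hm, Module.End.mul_apply, mulOp_apply]
  refine coeff_of_lt_order ((Nat.cast_lt.mpr d.degree.lt_succ_self).trans_le
    (le_order_partialPow α ?_))
  have hc : (((m + α.degree).toNat : ℕ) : ℕ∞) ≤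
      (homogeneousComponent (m + α.degree).toNat h).order := by
    refine nat_le_order fun e he => ?_
    rw [coeff_homogeneousComponent, if_neg he.ne]
  refine (Nat.cast_le.mpr ?_).trans (le_order_mul_of_le (l := 0) hc (by simp))
  omega

theorem formalHasSum_weylComponent (α : Fin n →₀ ℕ) (h f : MvPowerSeries (Fin n) K) :
    FormalHasSum (fun m => weylComponent α h m f) (partialPow α (h * f)) := by
  let e : ℕ ↪ ℤ := ⟨fun p => (p : ℤ) - α.degree, fun a b hab => by simpa using hab⟩
  refine formalHasSum_of_finset (fun d => (Finset.range (d.degree + α.degree + 1)).map e)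
    (fun d m hm => ?_) fun d => ?_
  · by_cases h0 : 0 ≤ m + α.degree
    · by_cases hd : (d.degree : ℤ) < m
      · exact coeff_weylComponent_eq_zero α h f hd
      · refine absurd (Finset.mem_map.mpr ⟨(m + α.degree).toNat, ?_, ?_⟩) hm
        · rw [Finset.mem_range]
          omega
        · change (((m + α.degree).toNat : ℕ) : ℤ) - α.degree = m
          omega
    · simp [weylComponent, h0]
  · rw [Finset.sum_map]
    have he : ∀ p, weylComponent α h (e p) f = partialPow α (homogeneousComponent p h * f) := by
      intro p
      have : e p + α.degree = p := sub_add_cancel _ _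
      simp only [weylComponent, this, Int.natCast_nonneg, if_true, Int.toNat_natCast]
      rfl
    simp only [he]
    rw [← map_sum, ← map_sum, ← Finset.sum_mul, ← truncTotal_eq_sum, ← sub_eq_zero, ← map_sub,
      ← map_sub, ← sub_mul]
    refine coeff_of_lt_order ((Nat.cast_lt.mpr d.degree.lt_succ_self).trans_le
      (le_order_partialPow α ?_))
    refine (Nat.cast_le.mpr ?_).trans (le_order_mul_of_le (k := d.degree + α.degree + 1) (l := 0)
      (nat_le_order fun b hb => ?_) (by simp))
    · omega
    · rw [map_sub, MvPolynomial.coeff_coe, coeff_truncTotal _ hb, sub_self]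

/-- A family of operators `w ↦ ∂^α (h_α w)` with `o(h_α) ≥ 2|α|` can be summed in the completed
Weyl algebra over any set of exponents, degree by degree. -/
theorem mem_completedWeylGE {h : (Fin n →₀ ℕ) → MvPowerSeries (Fin n) K}
    (hh : ∀ α, ((2 * α.degree : ℕ) : ℕ∞) ≤ (h α).order) (p : (Fin n →₀ ℕ) → Prop)
    [DecidablePred p] {M : ℤ} (hp : ∀ α, p α → M ≤ α.degree)
    {T : Module.End K (MvPowerSeries (Fin n) K)}
    (hT : ∀ f, FormalHasSum (fun α => if p α then partialPow α (h α * f) else 0) (T f)) :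
    T ∈ completedWeylGE K n M := by
  -- Only the exponents with `|α| ≤ m` contribute to the component of degree `m`.
  refine ⟨fun m => ∑ α ∈ (degreeLE n m.toNat).filter p, weylComponent α (h α) m,
    fun m => Submodule.sum_mem _ fun α _ => weylComponent_mem _ _ _, fun m hm => ?_, fun f => ?_⟩
  · exact Finset.sum_eq_zero fun α hα => weylComponent_eq_zero (hh α)
      (hm.trans_le (hp α (Finset.mem_filter.mp hα).2))
  · refine formalHasSum_of_finset (fun d => Finset.Icc 0 (d.degree : ℤ)) (fun d m hm => ?_)
      fun d => ?_
    · rw [LinearMap.sum_apply, map_sum]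
      refine Finset.sum_eq_zero fun α _ => ?_
      by_cases h0 : m < 0
      · rw [weylComponent_eq_zero (hh α) (by omega)]
        simp
      · refine coeff_weylComponent_eq_zero _ _ _ ?_
        rw [Finset.mem_Icc] at hm
        omega
    -- For `m ≤ |d|` the sum over `|α| ≤ m` may be extended to `|α| ≤ |d|`, and the two finite sums,
    -- over `m` and over `α`, may then be exchanged.
    · rw [(hT f).coeff_eq_sum d (degreeLE n d.degree), ← Finset.sum_filter_add_sum_filter_not _ p]
      · rw [Finset.sum_congr rfl (g := fun m => ∑ α ∈ (degreeLE n d.degree).filter p,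
          coeff d (weylComponent α (h α) m f)), Finset.sum_comm, eq_comm]
        · rw [Finset.sum_eq_zero (s := Finset.filter (fun x => ¬p x) _), add_zero]
          · refine Finset.sum_congr rfl fun α hα => ?_
            rw [if_pos (Finset.mem_filter.mp hα).2]
            refine (formalHasSum_weylComponent α (h α) f).coeff_eq_sum d _ fun m hm => ?_
            by_cases h0 : m < 0
            · rw [weylComponent_eq_zero (hh α) (by omega)]
              simp
            · refine coeff_weylComponent_eq_zero _ _ _ ?_
              rw [Finset.mem_Icc] at hm
              omega
          · intro α hα
            rw [if_neg (Finset.mem_filter.mp hα).2, map_zero]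
        · intro m hm
          rw [Finset.mem_Icc] at hm
          rw [LinearMap.sum_apply, map_sum]
          refine Finset.sum_subset (fun α hα => ?_) fun α hα hα' => ?_
          · simp only [Finset.mem_filter, mem_degreeLE] at hα ⊢
            exact ⟨by omega, hα.2⟩
          · simp only [Finset.mem_filter, mem_degreeLE] at hα hα'
            rw [weylComponent_eq_zero (hh α) (by
              have : ¬ α.degree ≤ m.toNat := fun hle => hα' ⟨hle, hα.2⟩
              omega)]
            simp
      · intro α hα
        rw [mem_degreeLE, not_le] at hα
        split_ifs
        · refine coeff_of_lt_order ((Nat.cast_lt.mpr hα).trans_le (le_order_partialPow α ?_))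
          refine (Nat.cast_le.mpr ?_).trans (le_order_mul_of_le (l := 0) (hh α) (by simp))
          omega
        · simp

theorem weylHasSum_of_formalHasSum {h : (Fin n →₀ ℕ) → MvPowerSeries (Fin n) K}
    (hh : ∀ α, ((2 * α.degree : ℕ) : ℕ∞) ≤ (h α).order)
    {P : (Fin n →₀ ℕ) → Module.End K (MvPowerSeries (Fin n) K)}
    (hP : ∀ α f, P α f = partialPow α (h α * f))
    {T : Module.End K (MvPowerSeries (Fin n) K)}
    (hT : ∀ f, FormalHasSum (fun α => P α f) (T f)) : WeylHasSum P T := by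
  classical
  have hfin : ∀ (s : Finset (Fin n →₀ ℕ)) f, FormalHasSum
      (fun α => if α ∈ s then P α f else 0) ((∑ α ∈ s, P α) f) := fun s f =>
    formalHasSum_of_finset (fun _ => s) (fun d α hα => by simp [hα])
      (fun d => by simp +contextual [LinearMap.sum_apply])
  refine ⟨fun α => Set.mem_iUnion.mpr ⟨0, ?_⟩, Set.mem_iUnion.mpr ⟨0, ?_⟩, fun M => ?_⟩
  · refine mem_completedWeylGE hh (fun β => β ∈ ({α} : Finset _)) (by simp) fun f => ?_
    simpa only [hP, Finset.sum_singleton] using hfin {α} f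
  · refine mem_completedWeylGE hh (fun _ => True) (by simp) fun f => ?_
    simpa only [if_true, hP] using hT f
  · refine ⟨degreeLE n M.toNat, fun s hs => mem_completedWeylGE hh (fun α => α ∉ s)
      (fun α hα => ?_) fun f => ?_⟩
    · have : ¬ α.degree ≤ M.toNat := fun hle => hα (hs (mem_degreeLE.mpr hle))
      omega
    · have := (hT f).sub (hfin s f)
      rw [LinearMap.sub_apply]
      convert this using 2 with α
      by_cases hα : α ∈ s <;> simp [hα, hP]

/-! ### The inversion formula -/

theorem constantCoeff_X_sub {H : Fin n → MvPowerSeries (Fin n) K} (hH : 2 ≤ tupleOrder H)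
    (i : Fin n) : constantCoeff (X i - H i) = 0 := by
  rw [map_sub, constantCoeff_X, one_le_order_iff_constCoeff_eq_zero.mp
    (one_le_two.trans (hH.trans (iInf_le _ i))), sub_zero]

/-- The operator `u ↦ ∑_α (1/α!) ∂^α (u H^α 𝒥F)` exists, inverts the substitution of `F = z - H`,
and differs from the identity by an operator which raises orders. -/
theorem exists_inversion_operator [CharZero K] {H : Fin n → MvPowerSeries (Fin n) K}
    (hH : 2 ≤ tupleOrder H) :
    ∃ T : Module.End K (MvPowerSeries (Fin n) K),
      (∀ u, FormalHasSum
        (fun α => inversionTerm H α ((jacobian fun i => X i - H i) * u)) (T u)) ∧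
      (∀ p, T (subst (fun i => X i - H i) p) = p) ∧
      ∀ (k : ℕ) w, (k : ℕ∞) ≤ w.order → ((k + 1 : ℕ) : ℕ∞) ≤ (T w - w).order := by
  set F : Fin n → MvPowerSeries (Fin n) K := fun i => X i - H i with hF
  obtain ⟨S, hS⟩ := exists_operator_sum (inversionTerm H) fun α f => by
    simpa using le_order_inversionTerm hH α (k := 0) (w := f) (by simp)
  have hT : ∀ (k : ℕ) w, (k : ℕ∞) ≤ w.order →
      ((k + 1 : ℕ) : ℕ∞) ≤ ((S * mulOp (jacobian F)) w - w).order := by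
    intro k w hw
    have hJ : (k : ℕ∞) ≤ (jacobian F * w).order := by
      simpa using le_order_mul_of_le (k := 0) (f := jacobian F) (by simp) hw
    have h1 := le_order_sum_inversionTerm_sub hH hS hJ
    have h2 := le_order_mul_of_le (k := 1) (one_le_order_jacobian_sub_one hH) hw
    have hsplit : (S * mulOp (jacobian F)) w - w =
        (S (jacobian F * w) - jacobian F * w) + (jacobian F - 1) * w := by
      rw [Module.End.mul_apply, mulOp_apply]
      ring
    rw [hsplit]
    rw [add_comm 1 k] at h2
    exact (le_min h1 h2).trans min_order_le_add
  refine ⟨S * mulOp (jacobian F), fun u => hS _,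
    map_subst_eq (constantCoeff_X_sub hH) (fun i w => ?_) ?_ hT, hT⟩
  · rw [Module.End.mul_apply, mulOp_apply, mul_left_comm, sum_inversionTerm_mul hS i]
    rfl
  · rw [Module.End.mul_apply, mulOp_apply, mul_one, sum_inversionTerm_jacobian hH hS]

end AbhyankarGurjar

end

theorem mainTheorem1 {K : Type*} [Field K] [CharZero K] (n : ℕ)
    (F H : Fin n → MvPowerSeries (Fin n) K)
    (hF : ∀ i, F i = MvPowerSeries.X i - H i)
    (hH : 2 ≤ AbhyankarGurjar.tupleOrder H) :
    (∃! G : Fin n → MvPowerSeries (Fin n) K, AbhyankarGurjar.IsFormalInverse F G) ∧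
    ∀ G : Fin n → MvPowerSeries (Fin n) K, AbhyankarGurjar.IsFormalInverse F G →
      2 ≤ AbhyankarGurjar.tupleOrder (fun i => G i - MvPowerSeries.X i) ∧
      (∀ u : MvPowerSeries (Fin n) K,
        AbhyankarGurjar.FormalHasSum
          (fun α : Fin n →₀ ℕ => (AbhyankarGurjar.multiFactorial α : K)⁻¹ •
            AbhyankarGurjar.partialPow α
              (u * AbhyankarGurjar.multiPow H α * AbhyankarGurjar.jacobian F))
          (MvPowerSeries.subst G u)) ∧
      (∃ T : Module.End K (MvPowerSeries (Fin n) K),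
        AbhyankarGurjar.WeylHasSum
          (fun α : Fin n →₀ ℕ => (AbhyankarGurjar.multiFactorial α : K)⁻¹ •
            (AbhyankarGurjar.partialPow α *
              AbhyankarGurjar.mulOp (AbhyankarGurjar.multiPow H α) *
              AbhyankarGurjar.mulOp (AbhyankarGurjar.jacobian F))) T ∧
        ∀ u : MvPowerSeries (Fin n) K, T u = MvPowerSeries.subst G u) ∧
      (∀ i : Fin n,
        AbhyankarGurjar.FormalHasSum
          (fun α : Fin n →₀ ℕ => (AbhyankarGurjar.multiFactorial α : K)⁻¹ •
            AbhyankarGurjar.partialPow α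
              (MvPowerSeries.X i * AbhyankarGurjar.multiPow H α *
                AbhyankarGurjar.jacobian F))
          (G i)) := by
  open AbhyankarGurjar MvPowerSeries in
  obtain rfl : F = fun i => X i - H i := funext hF
  obtain ⟨T, hTsum, hFT, hT⟩ := exists_inversion_operator hH
  have hF0 := constantCoeff_X_sub hH
  have hTG : ∀ G, IsFormalInverse (fun i => X i - H i) G → ∀ u, T u = subst G u :=
    fun G hG => subst_eq_of_comp_left hF0 hG.constantCoeff_eq_zero hFT hG.comp_left
  have hTX : ∀ G, IsFormalInverse (fun i => X i - H i) G → ∀ i, G i = T (X i) :=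
    fun G hG i => by
      rw [hTG G hG, subst_X (hasSubst_of_constantCoeff_zero hG.constantCoeff_eq_zero)]
  have hsum : ∀ u, FormalHasSum (fun α : Fin n →₀ ℕ => (multiFactorial α : K)⁻¹ •
      partialPow α (u * multiPow H α * jacobian fun i => X i - H i)) (T u) := by
    intro u
    convert hTsum u using 2 with α
    rw [inversionTerm_apply]
    congr 2
    ring
  refine ⟨⟨_, isFormalInverse_map_X hF0 hFT hT, fun G hG => funext (hTX G hG)⟩, fun G hG =>
    ⟨le_iInf fun i => ?_, fun u => hTG G hG u ▸ hsum u, ⟨T, ?_, hTG G hG⟩,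
      fun i => hTX G hG i ▸ hsum (X i)⟩⟩
  · change 2 ≤ (G i - X i).order
    rw [hTX G hG]
    refine hT 1 (X i) ?_
    rw [Nat.cast_one, one_le_order_iff_constCoeff_eq_zero, constantCoeff_X]
  · refine weylHasSum_of_formalHasSum
      (h := fun α => (multiFactorial α : K)⁻¹ • (multiPow H α * jacobian fun i => X i - H i))
      (fun α => ?_) (fun α f => ?_) hTsum
    · refine le_trans ?_ le_order_smul
      simpa using le_order_mul_of_le (l := 0) (le_order_multiPow hH α) (by simp)
    · rw [smul_mul_assoc, map_smul, mul_assoc (multiPow H α)]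
      rfl
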